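/- Let $n\ge 2$. The affine symmetric group $\widetilde S_n$ is the group, under composition, of all bijections $w:\mathbb Z\to\mathbb Z$ such that $w(i+n)=w(i)+n$ for all $i\in\mathbb Z$ and $w(1)+w(2)+\cdots+w(n)=1+2+\cdots+n$. It is generated by the $n$ adjacent transpositions $s_0,\dots,s_{n-1}$, where $s_i$ interchanges $i+mn$ and $i+1+mn$ simultaneously for all $m\in\mathbb Z$ and fixes all other integers; the Coxeter length $\ell(w)$ is the minimal number of adjacent transpositions whose product is $w$. For a permutation $p=p_1\cdots p_k\in S_k$, we say that $w\in\widetilde S_n$ contains $p$ if there are integers $i_1<i_2<\cdots<i_k$ such that $w(i_1),\dots,w(i_k)$ are in the same relative order as $p_1,\dots,p_k$; otherwise $w$ avoids $p$. For every $k$, every permutation $p\in S_k$ and every $n\ge 2$, the generating series $$F_{p,n}(x)=\sum_{\substack{w\in\widetilde S_n\\ w\text{ avoids }p}}x^{\ell(w)}$$ is rational, that is, there are polynomials $P,Q\in\mathbb Q[x]$ with $Q(0)\ne 0$ and $Q\cdot F_{p,n}=P$ as formal power series. Equivalently, its sequence of coefficients $(a_m)_{m\ge 0}$, where $a_m$ is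 the (finite) number of $p$-avoiding $w\in\widetilde S_n$ with $\ell(w)=m$, satisfies a linear recurrence with constant coefficients: there are $d\ge 0$ and $c_0,\dots,c_{d-1}\in\mathbb Q$ with $a_{m+d}=\sum_{i=0}^{d-1}c_i\,a_{m+i}$ for all $m\ge 0$. -/

import Mathlib

open scoped Polynomial PowerSeries

namespace AffinePattern

theorem map_add_mul {n : ℕ} {v : Equiv.Perm ℤ} (hv : ∀ i, v (i + n) = v i + n) (i t : ℤ) :
    v (i + n * t) = v i + n * t := by
  induction t using Int.induction_on with
  | zero => simp
  | succ t ih =>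
    have := hv (i + n * t)
    rw [ih] at this
    rw [show i + (n : ℤ) * (t + 1) = i + n * t + n by ring, this]; ring
  | pred t ih =>
    have := hv (i + n * (-t - 1))
    rw [show i + (n : ℤ) * (-t - 1) + n = i + n * (-t) by ring, ih] at this
    linarith

theorem symm_map_add {n : ℕ} {v : Equiv.Perm ℤ} (hv : ∀ i, v (i + n) = v i + n) (i : ℤ) :
    v⁻¹ (i + n) = v⁻¹ i + n := by
  apply v.injective
  rw [hv]; simp

theorem sum_comp {n : ℕ} {v : Equiv.Perm ℤ} (hv : ∀ i, v (i + n) = v i + n) (g : ℤ → ℤ)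
    (hg : ∀ i, g (i + n) = g i) :
    ∑ i ∈ Finset.Icc (1 : ℤ) n, g (v i) = ∑ i ∈ Finset.Icc (1 : ℤ) n, g i := by
  rcases Nat.eq_zero_or_pos n with rfl | hn
  · simp
  have hn' : (0 : ℤ) < n := by exact_mod_cast hn
  have key : ∀ x : ℤ, (x - 1) % n + 1 = x + n * (-((x - 1) / n)) := by
    intro x
    have := Int.emod_add_mul_ediv (x - 1) n
    linarith
  have hg' : ∀ i t : ℤ, g (i + n * t) = g i := by
    intro i t
    induction t using Int.induction_on with
    | zero => simp
    | succ t ih => rw [← ih, ← hg (i + n * t)]; congr 1; ring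
    | pred t ih => rw [← ih, ← hg (i + n * (-t - 1))]; congr 1; ring
  have mem : ∀ x : ℤ, (x - 1) % n + 1 ∈ Finset.Icc (1 : ℤ) n := by
    intro x
    rw [Finset.mem_Icc]
    have h1 := Int.emod_nonneg (x - 1) hn'.ne'
    have h2 := Int.emod_lt_of_pos (x - 1) hn'
    constructor <;> omega
  have inv : ∀ u : Equiv.Perm ℤ, (∀ i, u (i + n) = u i + n) → ∀ i ∈ Finset.Icc (1 : ℤ) n,
      (u⁻¹ ((u i - 1) % n + 1) - 1) % n + 1 = i := by
    intro u hu i hi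
    rw [Finset.mem_Icc] at hi
    rw [key (u i), map_add_mul (symm_map_add hu)]
    rw [show u⁻¹ (u i) = i from u.symm_apply_apply i]
    rw [show ∀ c : ℤ, i + n * c - 1 = (i - 1) + n * c by intro c; ring, Int.add_mul_emod_self_left,
      Int.emod_eq_of_lt (by omega) (by omega)]
    ring
  refine Finset.sum_bij' (fun i _ => (v i - 1) % n + 1) (fun i _ => (v⁻¹ i - 1) % n + 1)
    (fun i _ => mem _) (fun i _ => mem _) (inv v hv) ?_ ?_
  · intro i hi
    simpa using inv v⁻¹ (symm_map_add hv) i hi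
  · intro i _
    rw [key, hg']

theorem sum_sub_comp {n : ℕ} {v w : Equiv.Perm ℤ} (hv : ∀ i, v (i + n) = v i + n)
    (hw : ∀ i, w (i + n) = w i + n) :
    ∑ i ∈ Finset.Icc (1 : ℤ) n, (w (v i) - v i) = ∑ i ∈ Finset.Icc (1 : ℤ) n, (w i - i) :=
  sum_comp hv (fun j => w j - j) (fun i => by rw [hw]; ring)

end AffinePattern

/-- The affine symmetric group: bijections `w : ℤ → ℤ` with `w (i + n) = w i + n` for all `i` and
`w 1 + ⋯ + w n = 1 + ⋯ + n`, under composition. -/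
def AffineSymmetricGroup (n : ℕ) : Subgroup (Equiv.Perm ℤ) where
  carrier := {w | (∀ i : ℤ, w (i + n) = w i + n) ∧
    ∑ i ∈ Finset.Icc (1 : ℤ) n, w i = ∑ i ∈ Finset.Icc (1 : ℤ) n, i}
  one_mem' := ⟨fun _ => rfl, rfl⟩
  mul_mem' := by
    rintro w v ⟨hw, hw'⟩ ⟨hv, hv'⟩
    refine ⟨fun i => by simp [hv, hw], ?_⟩
    have h := AffinePattern.sum_sub_comp hv hw
    simp only [Finset.sum_sub_distrib] at h
    simp only [Equiv.Perm.mul_apply]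
    linarith
  inv_mem' := by
    rintro w ⟨hw, hw'⟩
    have hi := AffinePattern.symm_map_add hw
    refine ⟨hi, ?_⟩
    have h := AffinePattern.sum_sub_comp hi hw
    have e : ∀ i, w (w⁻¹ i) = i := w.apply_symm_apply
    simp only [Finset.sum_sub_distrib, e] at h
    linarith

namespace AffinePattern

/-- `s` is one of the adjacent transpositions of `AffineSymmetricGroup n`: for some `i` it swaps
`i + m n` and `i + 1 + m n` for all `m : ℤ` at once and fixes everything else.  (Only the residue
of `i` modulo `n` matters, so for `n ≥ 2` there are `n` of these.) -/
def IsAdjacentTransposition (n : ℕ) (s : AffineSymmetricGroup n) : Prop :=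
  ∃ i : ℤ, ∀ j : ℤ, (s : Equiv.Perm ℤ) j =
    if (n : ℤ) ∣ j - i then j + 1 else if (n : ℤ) ∣ j - (i + 1) then j - 1 else j

/-- The Coxeter length of `w`: the minimal number of adjacent transpositions whose product is `w`.
By `exists_word` below, the minimum is over a non-empty set when `n ≥ 2`. -/
noncomputable def coxeterLength (n : ℕ) (w : AffineSymmetricGroup n) : ℕ :=
  sInf {m : ℕ | ∃ l : List (AffineSymmetricGroup n),
    (∀ s ∈ l, IsAdjacentTransposition n s) ∧ l.length = m ∧ l.prod = w}

/-- `w` contains `p ∈ S_k`: there are positions `i_1 < ⋯ < i_k` in `ℤ` at which the values of `w`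
are in the same relative order as `p_1, …, p_k`. -/
def Contains {n k : ℕ} (w : AffineSymmetricGroup n) (p : Equiv.Perm (Fin k)) : Prop :=
  ∃ i : Fin k → ℤ, StrictMono i ∧
    ∀ a b : Fin k, (w : Equiv.Perm ℤ) (i a) < (w : Equiv.Perm ℤ) (i b) ↔ p a < p b

/-- `w` avoids `p`. -/
def Avoids {n k : ℕ} (w : AffineSymmetricGroup n) (p : Equiv.Perm (Fin k)) : Prop :=
  ¬ Contains w p

/-- The generating series `F_{p,n}(x) = ∑ x ^ ℓ(w)` over the `w ∈ AffineSymmetricGroup n` that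
avoid `p`: its `m`-th coefficient counts such `w` with `ℓ(w) = m`.  By `finite_length_eq` below,
these are finitely many when `n ≥ 2`. -/
noncomputable def generatingSeries {k : ℕ} (p : Equiv.Perm (Fin k)) (n : ℕ) : ℚ⟦X⟧ :=
  PowerSeries.mk fun m =>
    (({w : AffineSymmetricGroup n | Avoids w p ∧ coxeterLength n w = m}.ncard : ℕ) : ℚ)

/-- A formal power series is rational if it is the expansion of a quotient `P / Q` of polynomials
with `Q(0) ≠ 0`. -/
def IsRationalSeries (F : ℚ⟦X⟧) : Prop :=
  ∃ P Q : ℚ[X], Q.coeff 0 ≠ 0 ∧ (Q : ℚ⟦X⟧) * F = (P : ℚ⟦X⟧)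

/-! The remaining facts show that the length and the series are well defined. -/

theorem sum_ite_dvd {n : ℕ} (hn : 0 < n) (i A : ℤ) :
    ∑ j ∈ Finset.Icc (1 : ℤ) n, (if (n : ℤ) ∣ j - i then A else 0) = A := by
  have hn' : (0 : ℤ) < n := by exact_mod_cast hn
  have h1 := Int.emod_nonneg (i - 1) hn'.ne'
  have h2 := Int.emod_lt_of_pos (i - 1) hn'
  have h3 := Int.emod_add_mul_ediv (i - 1) n
  rw [Finset.sum_eq_single ((i - 1) % n + 1)]
  · rw [if_pos]
    exact ⟨-((i - 1) / n), by linarith⟩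
  · intro j hj hne
    rw [Finset.mem_Icc] at hj
    rw [if_neg]
    intro hd
    apply hne
    have : (j - 1) % n = (i - 1) % n := by
      apply Int.ModEq.symm
      rw [Int.modEq_iff_dvd]
      simpa using hd
    rw [Int.emod_eq_of_lt (by omega) (by omega)] at this
    omega
  · intro h
    exact absurd (Finset.mem_Icc.2 ⟨by omega, by omega⟩) h

theorem not_dvd_both {n : ℕ} (hn : 2 ≤ n) {i j : ℤ} (h1 : (n : ℤ) ∣ j - i)
    (h2 : (n : ℤ) ∣ j - (i + 1)) : False := by
  have h := dvd_sub h1 h2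
  rw [show j - i - (j - (i + 1)) = 1 by ring] at h
  have := Int.le_of_dvd one_pos h
  omega

theorem exists_adjacentTransposition {n : ℕ} (hn : 2 ≤ n) (i : ℤ) :
    ∃ s : AffineSymmetricGroup n, ∀ j : ℤ, (s : Equiv.Perm ℤ) j =
      if (n : ℤ) ∣ j - i then j + 1 else if (n : ℤ) ∣ j - (i + 1) then j - 1 else j := by
  let f : ℤ → ℤ := fun j =>
    if (n : ℤ) ∣ j - i then j + 1 else if (n : ℤ) ∣ j - (i + 1) then j - 1 else j
  have hf : Function.Involutive f := by
    intro j
    simp only [f]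
    by_cases h1 : (n : ℤ) ∣ j - i
    · have h2 : (n : ℤ) ∣ j + 1 - (i + 1) := by simpa using h1
      rw [if_pos h1, if_neg (fun h => not_dvd_both hn h h2), if_pos h2]; ring
    · rw [if_neg h1]
      by_cases h2 : (n : ℤ) ∣ j - (i + 1)
      · rw [if_pos h2, if_pos (by rwa [show j - 1 - i = j - (i + 1) by ring])]; ring
      · rw [if_neg h2, if_neg h1, if_neg h2]
  refine ⟨⟨hf.toPerm f, ?_, ?_⟩, fun j => rfl⟩
  · intro j
    have e : ∀ c : ℤ, ((n : ℤ) ∣ j + n - c ↔ (n : ℤ) ∣ j - c) := fun c => by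
      rw [show j + n - c = j - c + n by ring]; simp
    simp only [Function.Involutive.coe_toPerm, f, e]
    split_ifs <;> ring
  · have : ∀ j : ℤ, f j = j + ((if (n : ℤ) ∣ j - i then 1 else 0) +
        (if (n : ℤ) ∣ j - (i + 1) then -1 else 0)) := by
      intro j
      simp only [f]
      by_cases h1 : (n : ℤ) ∣ j - i
      · rw [if_pos h1, if_pos h1, if_neg (fun h => not_dvd_both hn h1 h)]; ring
      · rw [if_neg h1, if_neg h1]; split_ifs <;> ring
    simp only [Function.Involutive.coe_toPerm, this, Finset.sum_add_distrib]
    rw [sum_ite_dvd (by omega), sum_ite_dvd (by omega)]; ring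

theorem eq_one_of_no_descent {n : ℕ} (hn : 2 ≤ n) (w : AffineSymmetricGroup n)
    (h : ∀ i : ℤ, (w : Equiv.Perm ℤ) i < (w : Equiv.Perm ℤ) (i + 1)) : w = 1 := by
  obtain ⟨w, hw, hw'⟩ := w
  simp only at h
  have hm : StrictMono w := strictMono_int_of_lt_succ h
  have hstep : ∀ i, w (i + 1) = w i + 1 := by
    intro i
    obtain ⟨j, hj⟩ := w.surjective (w i + 1)
    have h1 : i < j := hm.lt_iff_lt.1 (by omega)
    have h2 : w (i + 1) ≤ w j := hm.le_iff_le.2 (by omega)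
    have := h i
    omega
  have hc : ∀ i, w i = i + w 0 := by
    intro i
    induction i using Int.induction_on with
    | zero => simp
    | succ t ih => rw [hstep, ih]; ring
    | pred t ih =>
      have := hstep (-t - 1)
      rw [show (-t - 1 + 1 : ℤ) = -t by ring, ih] at this
      linarith
  have h0 : w 0 = 0 := by
    rw [Finset.sum_congr rfl (fun i _ => hc i), Finset.sum_add_distrib] at hw'
    simp only [Finset.sum_const, Int.card_Icc, add_eq_left, smul_eq_zero] at hw'
    rcases hw' with h | h
    · omega
    · exact h
  ext i
  simp [hc i, h0]

/-- The adjacent transpositions generate the affine symmetric group. -/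
theorem exists_word {n : ℕ} (hn : 2 ≤ n) (w : AffineSymmetricGroup n) :
    ∃ l : List (AffineSymmetricGroup n),
      (∀ s ∈ l, IsAdjacentTransposition n s) ∧ l.prod = w := by
  suffices H : ∀ (N : ℕ) (w : AffineSymmetricGroup n),
      ∑ j ∈ Finset.Icc (1 : ℤ) n, ((w : Equiv.Perm ℤ) j - j) ^ 2 ≤ N →
      ∃ l : List (AffineSymmetricGroup n),
        (∀ s ∈ l, IsAdjacentTransposition n s) ∧ l.prod = w from
    H _ w (Int.self_le_toNat _)
  intro N
  induction N with
  | zero =>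
    intro w hw
    refine ⟨[], by simp, ?_⟩
    have hz : ∀ j ∈ Finset.Icc (1 : ℤ) n, ((w : Equiv.Perm ℤ) j - j) ^ 2 = 0 :=
      (Finset.sum_eq_zero_iff_of_nonneg (fun _ _ => sq_nonneg _)).1
        (le_antisymm (by exact_mod_cast hw) (Finset.sum_nonneg fun _ _ => sq_nonneg _))
    symm
    ext i
    have hn' : (0 : ℤ) < n := by omega
    have h1 := Int.emod_nonneg (i - 1) hn'.ne'
    have h2 := Int.emod_lt_of_pos (i - 1) hn'
    have h3 := Int.emod_add_mul_ediv (i - 1) n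
    have h4 := hz ((i - 1) % n + 1) (Finset.mem_Icc.2 ⟨by omega, by omega⟩)
    have h5 := map_add_mul w.2.1 ((i - 1) % n + 1) ((i - 1) / n)
    rw [show (i - 1) % n + 1 + n * ((i - 1) / n) = i by linarith] at h5
    have h6 := pow_eq_zero_iff (two_ne_zero) |>.1 h4
    simp only [List.prod_nil, OneMemClass.coe_one, Equiv.Perm.one_apply]
    linarith
  | succ N ih =>
    intro w hw
    by_cases hd : ∀ i : ℤ, (w : Equiv.Perm ℤ) i < (w : Equiv.Perm ℤ) (i + 1)
    · exact ⟨[], by simp, (eq_one_of_no_descent hn w hd).symm⟩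
    push Not at hd
    obtain ⟨i, hi⟩ := hd
    have hlt : (w : Equiv.Perm ℤ) (i + 1) < (w : Equiv.Perm ℤ) i :=
      lt_of_le_of_ne hi (fun h => by have := (w : Equiv.Perm ℤ).injective h; omega)
    obtain ⟨s, hs⟩ := exists_adjacentTransposition hn i
    have hss : s * s = 1 := by
      ext j
      simp only [Subgroup.coe_mul, Equiv.Perm.mul_apply, OneMemClass.coe_one, Equiv.Perm.one_apply]
      rw [hs j]
      by_cases h1 : (n : ℤ) ∣ j - i
      · have h2 : (n : ℤ) ∣ j + 1 - (i + 1) := by simpa using h1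
        rw [if_pos h1, hs, if_neg (fun h => not_dvd_both hn h h2), if_pos h2]; ring
      · rw [if_neg h1]
        by_cases h2 : (n : ℤ) ∣ j - (i + 1)
        · rw [if_pos h2, hs, if_pos (by rwa [show j - 1 - i = j - (i + 1) by ring])]; ring
        · rw [if_neg h2, hs, if_neg h1, if_neg h2]
    have hsum := sum_comp s.2.1 (fun j => ((w : Equiv.Perm ℤ) j - j) ^ 2)
      (fun j => by simp only [w.2.1]; ring)
    have hper : ∀ j, (n : ℤ) ∣ j - i → (w : Equiv.Perm ℤ) j = (w : Equiv.Perm ℤ) i + (j - i) := by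
      rintro j ⟨t, ht⟩
      rw [show j = i + n * t by linarith, map_add_mul w.2.1]; ring
    have hper' : ∀ j, (n : ℤ) ∣ j - (i + 1) →
        (w : Equiv.Perm ℤ) j = (w : Equiv.Perm ℤ) (i + 1) + (j - (i + 1)) := by
      rintro j ⟨t, ht⟩
      rw [show j = i + 1 + n * t by linarith, map_add_mul w.2.1]; ring
    have hterm : ∀ j : ℤ, (((w * s : AffineSymmetricGroup n) : Equiv.Perm ℤ) j - j) ^ 2 =
        ((w : Equiv.Perm ℤ) ((s : Equiv.Perm ℤ) j) - (s : Equiv.Perm ℤ) j) ^ 2 +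
        ((if (n : ℤ) ∣ j - i then 2 * ((w : Equiv.Perm ℤ) (i + 1) - (i + 1)) + 1 else 0) +
        (if (n : ℤ) ∣ j - (i + 1) then -2 * ((w : Equiv.Perm ℤ) i - i) + 1 else 0)) := by
      intro j
      simp only [Subgroup.coe_mul, Equiv.Perm.mul_apply]
      by_cases h1 : (n : ℤ) ∣ j - i
      · have h2 : (n : ℤ) ∣ j + 1 - (i + 1) := by simpa using h1
        rw [hs, if_pos h1, if_pos h1, if_neg (fun h => not_dvd_both hn h1 h), hper' _ h2]; ring
      · by_cases h2 : (n : ℤ) ∣ j - (i + 1)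
        · have h3 : (n : ℤ) ∣ j - 1 - i := by rwa [show j - 1 - i = j - (i + 1) by ring]
          rw [hs, if_neg h1, if_neg h1, if_pos h2, if_pos h2, hper _ h3]; ring
        · rw [hs, if_neg h1, if_neg h1, if_neg h2, if_neg h2]; ring
    obtain ⟨l, hl, hlw⟩ := ih (w * s) (by
      simp only [hterm, Finset.sum_add_distrib]
      rw [hsum, sum_ite_dvd (by omega), sum_ite_dvd (by omega)]
      push_cast at hw
      linarith)
    refine ⟨l ++ [s], ?_, ?_⟩
    · intro r hr
      rcases List.mem_append.1 hr with h | h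
      · exact hl r h
      · rw [List.mem_singleton.1 h]; exact ⟨i, hs⟩
    · simp [hlw, mul_assoc, hss]

theorem finite_adjacentTranspositions {n : ℕ} (hn : 2 ≤ n) :
    {s : AffineSymmetricGroup n | IsAdjacentTransposition n s}.Finite := by
  choose f hf using fun i : ℤ => exists_adjacentTransposition hn i
  refine ((Finset.Icc (1 : ℤ) n).finite_toSet.image f).subset ?_
  rintro s ⟨i, hi⟩
  have hn' : (0 : ℤ) < n := by omega
  have h1 := Int.emod_nonneg (i - 1) hn'.ne'
  have h2 := Int.emod_lt_of_pos (i - 1) hn'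
  have h3 := Int.emod_add_mul_ediv (i - 1) n
  refine ⟨(i - 1) % n + 1, by simp only [Finset.coe_Icc, Set.mem_Icc]; omega, ?_⟩
  ext j
  have e : ∀ c : ℤ, ((n : ℤ) ∣ j - ((i - 1) % n + 1 + c) ↔ (n : ℤ) ∣ j - (i + c)) := fun c => by
    rw [show j - ((i - 1) % n + 1 + c) = j - (i + c) + n * ((i - 1) / n) by linarith]
    simp
  have e0 := e 0
  simp only [add_zero] at e0
  rw [hf, hi]
  simp only [e, e0]

/-- There are only finitely many elements of each Coxeter length. -/
theorem finite_length_eq {n : ℕ} (hn : 2 ≤ n) (m : ℕ) :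
    {w : AffineSymmetricGroup n | coxeterLength n w = m}.Finite := by
  have : Finite {s : AffineSymmetricGroup n | IsAdjacentTransposition n s} :=
    finite_adjacentTranspositions hn
  refine ((List.finite_length_eq {s : AffineSymmetricGroup n | IsAdjacentTransposition n s}
    m).image (fun l => (l.map Subtype.val).prod)).subset ?_
  intro w hw
  obtain ⟨l₀, hl₀, hp₀⟩ := exists_word hn w
  obtain ⟨l, hl, hlm, hp⟩ := Nat.sInf_mem
    (s := {m : ℕ | ∃ l : List (AffineSymmetricGroup n),
      (∀ s ∈ l, IsAdjacentTransposition n s) ∧ l.length = m ∧ l.prod = w})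
    ⟨l₀.length, l₀, hl₀, rfl, hp₀⟩
  have hw' : coxeterLength n w = m := hw
  lift l to List {s : AffineSymmetricGroup n | IsAdjacentTransposition n s} using hl
  refine ⟨l, ?_, hp⟩
  rw [List.length_map] at hlm
  exact hlm.trans hw'

end AffinePattern

/-! An element `w` is determined by its window `(w 1, …, w n) ∈ ℤⁿ`, and everything needed about `w`
is expressible in linear integer arithmetic on the window. The windows are the vectors with the
right sum and pairwise incongruent entries (`exists_window_eq`). The length is half of `∑ |⌊(w j - w
i)/n⌋ - ⌊(j - i)/n⌋|` (`two_mul_coxeterLength`), a Shi-type inversion formula. Containing `p` means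
that integers satisfying finitely many linear inequalities exist, after a finite choice of residues
for the positions (`contains_iff_window`). Semilinear sets are closed under Boolean operations and
projection, so the pairs (window, length) of the `p`-avoiding elements form a semilinear set in `ℤⁿ
× ℤ`.

It remains to see that counting a semilinear set by a nonnegative linear weight with finite fibres
gives a rational series (`isRationalSeries_of_isSemilinearSet`). Inclusion-exclusion reduces this to
finite unions of translates of one finitely generated monoid. There, each point has a
lexicographically least expression in the generators. The tuples that are not least form an upper
set of `ℕ^r`, which by Dickson's lemma is a finite union of translated orthants, and the series of
an orthant is `∏ 1 / (1 - X ^ c i)`. -/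

open Set

namespace AffinePattern

/-! ### Rational power series and linear recurrences. -/

theorem IsRationalSeries.add {F G : ℚ⟦X⟧} (hF : IsRationalSeries F) (hG : IsRationalSeries G) :
    IsRationalSeries (F + G) := by
  obtain ⟨P, Q, hQ, h⟩ := hF
  obtain ⟨P', Q', hQ', h'⟩ := hG
  refine ⟨P * Q' + P' * Q, Q * Q', by simp [Polynomial.mul_coeff_zero, hQ, hQ'], ?_⟩
  push_cast
  rw [← h, ← h']
  ring

theorem IsRationalSeries.neg {F : ℚ⟦X⟧} (hF : IsRationalSeries F) : IsRationalSeries (-F) := by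
  obtain ⟨P, Q, hQ, h⟩ := hF
  exact ⟨-P, Q, hQ, by push_cast; rw [← h]; ring⟩

theorem IsRationalSeries.sub {F G : ℚ⟦X⟧} (hF : IsRationalSeries F) (hG : IsRationalSeries G) :
    IsRationalSeries (F - G) := by
  rw [sub_eq_add_neg]
  exact hF.add hG.neg

theorem IsRationalSeries.coe (P : ℚ[X]) : IsRationalSeries (P : ℚ⟦X⟧) :=
  ⟨P, 1, by simp, by simp⟩

theorem IsRationalSeries.coe_mul {F : ℚ⟦X⟧} (P : ℚ[X]) (hF : IsRationalSeries F) :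
    IsRationalSeries (P * F) := by
  obtain ⟨P', Q, hQ, h⟩ := hF
  exact ⟨P * P', Q, hQ, by push_cast; rw [← h]; ring⟩

theorem IsRationalSeries.of_coe_mul {F : ℚ⟦X⟧} {Q : ℚ[X]} (hQ : Q.coeff 0 ≠ 0)
    (hF : IsRationalSeries (Q * F)) : IsRationalSeries F := by
  obtain ⟨P', Q', hQ', h⟩ := hF
  exact ⟨P', Q' * Q, by simp [Polynomial.mul_coeff_zero, hQ, hQ'],
    by push_cast; rw [← h]; ring⟩

theorem IsRationalSeries.exists_isSolution {F : ℚ⟦X⟧} (hF : IsRationalSeries F) :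
    ∃ E : LinearRecurrence ℚ, E.IsSolution (fun m => PowerSeries.coeff m F) := by
  obtain ⟨P, Q, hQ, h⟩ := hF
  -- With `d` above both degrees, the coefficient of `P` at `m + d` vanishes and only the last `d +
  -- 1` terms of the convolution survive; `Q(0) ≠ 0` then allows solving for the newest one.
  let d := max P.natDegree Q.natDegree + 1
  refine ⟨⟨d, fun i => -(Q.coeff (d - i) / Q.coeff 0)⟩, fun m => ?_⟩
  rw [mul_comm] at h
  have hc := congrArg (PowerSeries.coeff (m + d)) h
  rw [PowerSeries.coeff_mul, Polynomial.coeff_coe,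
    Polynomial.coeff_eq_zero_of_natDegree_lt (by omega),
    Finset.Nat.sum_antidiagonal_eq_sum_range_succ
      (fun i j => PowerSeries.coeff i F * PowerSeries.coeff j (Q : ℚ⟦X⟧)),
    Finset.sum_range_succ, Finset.sum_range_add, Finset.sum_eq_zero, zero_add, Nat.sub_self] at hc
  · simp only [Polynomial.coeff_coe, Nat.add_sub_add_left] at hc
    rw [Finset.sum_range] at hc
    simp only [neg_mul, Finset.sum_neg_distrib]
    rw [eq_neg_iff_add_eq_zero, ← mul_right_inj' hQ, mul_zero, mul_add, Finset.mul_sum, ← hc,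
      add_comm, mul_comm (Q.coeff 0)]
    congr 1
    exact Finset.sum_congr rfl fun i _ => by field_simp
  · intro i hi
    rw [Finset.mem_range] at hi
    rw [Polynomial.coeff_coe, Polynomial.coeff_eq_zero_of_natDegree_lt (by omega), mul_zero]

/-! ### Counting series of weighted sets. -/

/-- The series counting the elements of `s` by their weight `φ`. -/
noncomputable def weightSeries {N : Type*} (φ : N → ℤ) (s : Set N) : ℚ⟦X⟧ :=
  PowerSeries.mk fun m => (({x ∈ s | φ x = m}.ncard : ℕ) : ℚ)

/-- `s` has finitely many elements of each natural weight. -/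
def HasFiniteFibers {N : Type*} (φ : N → ℤ) (s : Set N) : Prop :=
  ∀ m : ℕ, {x ∈ s | φ x = m}.Finite

section weightSeries

variable {N N' : Type*} {φ : N → ℤ} {s t : Set N}

theorem HasFiniteFibers.mono (ht : HasFiniteFibers φ t) (h : s ⊆ t) : HasFiniteFibers φ s :=
  fun m => (ht m).subset fun _ hx => ⟨h hx.1, hx.2⟩

@[simp]
theorem weightSeries_empty : weightSeries φ ∅ = 0 := by
  ext m
  simp [weightSeries]

theorem weightSeries_union_add_inter (hs : HasFiniteFibers φ s) (ht : HasFiniteFibers φ t) :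
    weightSeries φ (s ∪ t) + weightSeries φ (s ∩ t) = weightSeries φ s + weightSeries φ t := by
  ext m
  simp only [weightSeries, map_add, PowerSeries.coeff_mk]
  have := Set.ncard_union_add_ncard_inter _ _ (hs m) (ht m)
  rw [← Nat.cast_add, ← Nat.cast_add, ← this]
  congr 3
  · ext x
    exact or_and_right
  · ext x
    exact and_and_right

theorem weightSeries_union (hs : HasFiniteFibers φ s) (ht : HasFiniteFibers φ t)
    (h : Disjoint s t) : weightSeries φ (s ∪ t) = weightSeries φ s + weightSeries φ t := by
  rw [← weightSeries_union_add_inter hs ht, h.inter_eq, weightSeries_empty, add_zero]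

/-- An injection that raises the weight by `e` multiplies the series by `X ^ e`. -/
theorem weightSeries_image {φ' : N' → ℤ} {f : N → N'} (e : ℕ) (hf : InjOn f s)
    (h0 : ∀ x ∈ s, 0 ≤ φ x) (h : ∀ x ∈ s, φ' (f x) = φ x + e) :
    weightSeries φ' (f '' s) = PowerSeries.X ^ e * weightSeries φ s := by
  ext m
  rw [PowerSeries.coeff_X_pow_mul']
  simp only [weightSeries, PowerSeries.coeff_mk]
  split_ifs with hm
  · congr 1
    rw [← (hf.mono fun x hx => hx.1 : InjOn f {x ∈ s | _}).ncard_image]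
    congr 1
    ext y
    constructor
    · rintro ⟨⟨x, hx, rfl⟩, hy⟩
      exact ⟨x, ⟨hx, by have := h x hx; push_cast [hm]; omega⟩, rfl⟩
    · rintro ⟨x, ⟨hx, hy⟩, rfl⟩
      exact ⟨⟨x, hx, rfl⟩, by rw [h x hx, hy]; push_cast [hm]; ring⟩
  · rw [Nat.cast_eq_zero]
    refine (congrArg ncard (eq_empty_iff_forall_notMem.2 ?_)).trans (ncard_empty _)
    rintro y ⟨⟨x, hx, rfl⟩, hy⟩
    have := h x hx
    have := h0 x hx
    omega

theorem weightSeries_image_of_eq {φ' : N' → ℤ} {f : N → N'} (hf : InjOn f s)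
    (h0 : ∀ x ∈ s, 0 ≤ φ x) (h : ∀ x ∈ s, φ' (f x) = φ x) :
    weightSeries φ' (f '' s) = weightSeries φ s := by
  simpa using weightSeries_image 0 hf h0 (by simpa using h)

/-- Rationality passes from a class of sets closed under intersection to finite unions. -/
theorem isRationalSeries_biUnion {C : Set (Set N)} (hC : ∀ a ∈ C, ∀ b ∈ C, a ∩ b ∈ C)
    (hfin : ∀ a ∈ C, HasFiniteFibers φ a) (hrat : ∀ a ∈ C, IsRationalSeries (weightSeries φ a))
    {ι : Type*} (I : Finset ι) (f : ι → Set N) (hf : ∀ i ∈ I, f i ∈ C) :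
    IsRationalSeries (weightSeries φ (⋃ i ∈ I, f i)) := by
  classical
  induction I using Finset.induction_on generalizing f with
  | empty => simpa using IsRationalSeries.coe 0
  | insert a I _ ih =>
    have ha := hf a (Finset.mem_insert_self _ _)
    have hI : ∀ i ∈ I, f i ∈ C := fun i hi => hf i (Finset.mem_insert_of_mem hi)
    have hU : HasFiniteFibers φ (⋃ i ∈ I, f i) := by
      intro m
      refine (I.finite_toSet.biUnion fun i hi => hfin _ (hI i hi) m).subset ?_
      rintro x ⟨hx, hm⟩
      simp only [mem_iUnion] at hx ⊢
      obtain ⟨i, hi, hx⟩ := hx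
      exact ⟨i, hi, hx, hm⟩
    -- Inclusion-exclusion: `f a ∩ ⋃ f i` is the union of the sets `f a ∩ f i`, which lie in `C` and
    -- are indexed by the same `I`, so the induction hypothesis covers it too.
    rw [Finset.set_biUnion_insert,
      eq_sub_of_add_eq (weightSeries_union_add_inter (hfin _ ha) hU), inter_iUnion₂]
    exact ((hrat _ ha).add (ih f hI)).sub (ih _ fun i hi => hC _ ha _ (hI i hi))

end weightSeries

/-! ### Orthants and upper sets in `ℕ^ι`. -/

section orthant

variable {ι : Type*} [Fintype ι] {c : ι → ℕ}

theorem hasFiniteFibers_orthant (hc : ∀ i, 0 < c i) (s : Set (ι → ℕ)) :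
    HasFiniteFibers (fun z => ∑ i, (c i : ℤ) * z i) s := fun m => by
  classical
  refine (finite_Iic (fun _ : ι => m)).subset ?_
  rintro z ⟨-, hz⟩ i
  have h1 : (c i : ℤ) * z i ≤ m := by
    rw [← hz]
    exact Finset.single_le_sum (f := fun i => (c i : ℤ) * z i) (fun _ _ => by positivity)
      (Finset.mem_univ i)
  have h2 : z i ≤ c i * z i := Nat.le_mul_of_pos_left _ (hc i)
  exact h2.trans (by exact_mod_cast h1)

/-- The coordinates are freed one at a time. Once `a` is free, the set `T` splits into the points
with `z a = 0` and the shift of `T` by the unit vector at `a`, so multiplying its series by `1 - X ^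
c a` gives back the previous series. -/
theorem isRationalSeries_orthant (hc : ∀ i, 0 < c i) :
    IsRationalSeries (weightSeries (fun z : ι → ℕ => ∑ i, (c i : ℤ) * z i) univ) := by
  classical
  suffices H : ∀ s : Finset ι, IsRationalSeries
      (weightSeries (fun z : ι → ℕ => ∑ i, (c i : ℤ) * z i) {z | ∀ i ∉ s, z i = 0}) by
    simpa using H Finset.univ
  intro s
  induction s using Finset.induction_on with
  | empty =>
    have h : ({z | ∀ i ∉ (∅ : Finset ι), z i = 0} : Set (ι → ℕ)) = {0} := by
      ext z
      simp [funext_iff]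
    have h1 : weightSeries (fun z : ι → ℕ => ∑ i, (c i : ℤ) * z i) {0} = (1 : ℚ[X]) := by
      ext m
      simp only [weightSeries, PowerSeries.coeff_mk, Polynomial.coe_one, PowerSeries.coeff_one]
      split_ifs with hm
      · subst hm
        rw [Nat.cast_eq_one, ncard_eq_one]
        refine ⟨0, subset_antisymm (fun z hz => hz.1) ?_⟩
        rintro z rfl
        exact ⟨rfl, by simp⟩
      · rw [Nat.cast_eq_zero]
        refine (congrArg ncard (eq_empty_iff_forall_notMem.2 ?_)).trans (ncard_empty _)
        rintro z ⟨rfl, hz⟩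
        simp at hz
        omega
    rw [h, h1]
    exact .coe _
  | insert a s ha ih =>
    set T : Set (ι → ℕ) := {z | ∀ i ∉ insert a s, z i = 0} with hT
    have hU : T = {z | ∀ i ∉ s, z i = 0} ∪ (fun z => z + Pi.single a 1) '' T := by
      ext z
      constructor
      · intro hz
        by_cases hza : z a = 0
        · refine Or.inl fun i hi => ?_
          by_cases hia : i = a
          · rwa [hia]
          · exact hz i (by simp [hia, hi])
        · refine Or.inr ⟨z - Pi.single a 1, fun i hi => by simp [hz i hi], ?_⟩
          ext i
          by_cases hia : i = a
          · subst hia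
            simp
            omega
          · simp [hia]
      · rintro (hz | ⟨y, hy, rfl⟩) i hi
        · exact hz i fun h => hi (Finset.mem_insert_of_mem h)
        · have : i ≠ a := fun h => hi (h ▸ Finset.mem_insert_self _ _)
          simp [hy i hi, this]
    have hdisj : Disjoint ({z | ∀ i ∉ s, z i = 0} : Set (ι → ℕ))
        ((fun z => z + Pi.single a 1) '' T) := by
      rw [disjoint_left]
      rintro _ hz ⟨y, -, rfl⟩
      simpa using hz a ha
    have h2 := weightSeries_union (hasFiniteFibers_orthant hc _) (hasFiniteFibers_orthant hc _)
      hdisj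
    rw [← hU, weightSeries_image (φ := fun z : ι → ℕ => ∑ i, (c i : ℤ) * z i) (c a)
      (add_left_injective _).injOn (fun _ _ => by positivity)] at h2
    · refine IsRationalSeries.of_coe_mul (Q := 1 - Polynomial.X ^ c a) ?_ ?_
      · simp [Polynomial.coeff_X_pow, (hc a).ne]
      · convert ih using 1
        push_cast
        rw [sub_mul, one_mul]
        exact sub_eq_of_eq_add h2
    · intro z _
      simp [mul_add, Finset.sum_add_distrib, Pi.single_apply]

theorem isRationalSeries_Ici (hc : ∀ i, 0 < c i) (v : ι → ℕ) :
    IsRationalSeries (weightSeries (fun z : ι → ℕ => ∑ i, (c i : ℤ) * z i) (Ici v)) := by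
  have h : Ici v = (fun z => z + v) '' univ := by
    ext z
    simp only [mem_Ici, image_univ, mem_range]
    exact ⟨fun h => ⟨z - v, tsub_add_cancel_of_le h⟩, by rintro ⟨y, rfl⟩; exact le_add_self⟩
  rw [h, weightSeries_image (φ := fun z : ι → ℕ => ∑ i, (c i : ℤ) * z i) (∑ i, c i * v i)
      (add_left_injective _).injOn (fun _ _ => by positivity)
      (fun z _ => by simp [mul_add, Finset.sum_add_distrib])]
  simpa using (isRationalSeries_orthant hc).coe_mul (Polynomial.X ^ (∑ i, c i * v i))

/-- Dickson's lemma: an upper set in `ι → ℕ` is a finite union of translated orthants. -/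
theorem isRationalSeries_upperSet (hc : ∀ i, 0 < c i) {U : Set (ι → ℕ)} (hU : IsUpperSet U) :
    IsRationalSeries (weightSeries (fun z : ι → ℕ => ∑ i, (c i : ℤ) * z i) U) := by
  have hfin : {v | Minimal (· ∈ U) v}.Finite :=
    WellQuasiOrderedLE.finite_of_isAntichain (setOfPred_minimal_antichain _)
  have h : U = ⋃ v ∈ hfin.toFinset, Ici v := by
    ext z
    simp only [Finite.mem_toFinset, mem_ofPred_eq, mem_iUnion, mem_Ici, exists_prop]
    constructor
    · intro hz
      obtain ⟨v, hvz, hv⟩ := (isPWO_of_wellQuasiOrderedLE U).exists_le_minimal hz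
      exact ⟨v, hv, hvz⟩
    · rintro ⟨v, hv, hvz⟩
      exact hU hvz hv.1
  rw [h]
  refine isRationalSeries_biUnion (C := range Ici) ?_ (fun a _ => hasFiniteFibers_orthant hc a)
    ?_ _ _ (fun v _ => mem_range_self v)
  · rintro _ ⟨v, rfl⟩ _ ⟨w, rfl⟩
    exact ⟨v ⊔ w, Ici_inter_Ici.symm⟩
  · rintro _ ⟨v, rfl⟩
    exact isRationalSeries_Ici hc v

end orthant

/-! ### Semilinear sets have rational weight series. -/

section monoid

variable {M : Type*} [AddCommGroup M] {r : ℕ} {c : Fin r → ℕ} {φ : M →+ ℤ}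
  {g : (Fin r → ℕ) →+ M}

/-- Each element of `u + range g` is represented by its lexicographically least preimage; the
preimages that are not least, or that land in `B`, form an upper set. -/
theorem isRationalSeries_translate_sdiff (hc : ∀ i, 0 < c i)
    (hg : ∀ z, φ (g z) = ∑ i, (c i : ℤ) * z i) {u : M} (hu : 0 ≤ φ u) {B : Set M}
    (hB : ∀ b ∈ B, ∀ z, b + g z ∈ B) :
    IsRationalSeries (weightSeries φ (range (fun z => u + g z) \ B)) := by
  set D : Set (Fin r → ℕ) :=
    {z | u + g z ∉ B ∧ ∀ z', toLex z' < toLex z → g z' ≠ g z} with hD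
  have hDU : IsUpperSet Dᶜ := by
    intro z y hzy hz
    obtain ⟨d, rfl⟩ := exists_add_of_le hzy
    simp only [hD, mem_compl_iff, mem_ofPred_eq, not_and_or, not_not, not_forall] at hz ⊢
    rcases hz with hz | ⟨z', hlt, hz'⟩
    · left
      rw [map_add, ← add_assoc]
      exact hB _ hz d
    · right
      -- The lexicographic order is translation invariant, so a smaller preimage stays smaller after
      -- adding `d`.
      exact ⟨z' + d, add_lt_add_left hlt (toLex d), by simp [hz']⟩
  have himg : range (fun z => u + g z) \ B = (fun z => u + g z) '' D := by
    ext x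
    constructor
    · rintro ⟨⟨z, rfl⟩, hx⟩
      obtain ⟨y, hy, hmin⟩ := WellFounded.has_min
        (wellFounded_lt (α := Lex (Fin r → ℕ))) {y | g (ofLex y) = g z} ⟨toLex z, rfl⟩
      have hy' : g (ofLex y) = g z := hy
      refine ⟨ofLex y, ⟨by rwa [hy'], fun z' hlt h => ?_⟩, by simp only [hy']⟩
      exact hmin (toLex z') (h.trans hy') hlt
    · rintro ⟨z, hz, rfl⟩
      exact ⟨⟨z, rfl⟩, hz.1⟩
  have hinj : InjOn (fun z => u + g z) D := by
    intro y hy z hz h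
    have h' : g y = g z := add_left_cancel h
    rcases lt_trichotomy (toLex y) (toLex z) with hlt | heq | hlt
    · exact absurd h' (hz.2 _ hlt)
    · exact heq
    · exact absurd h'.symm (hy.2 _ hlt)
  lift φ u to ℕ using hu with e he
  rw [himg, weightSeries_image (φ := fun z : Fin r → ℕ => ∑ i, (c i : ℤ) * z i) e hinj
    (fun _ _ => by positivity) (fun z _ => by rw [map_add, hg, ← he, add_comm])]
  -- The series of `D` is that of the orthant minus that of the upper set `Dᶜ`; translation by `u`
  -- contributes the factor `X ^ e`.
  have h1 := weightSeries_union (hasFiniteFibers_orthant hc D) (hasFiniteFibers_orthant hc Dᶜ)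
    disjoint_compl_right
  rw [union_compl_self] at h1
  have h2 := ((isRationalSeries_orthant hc).sub (isRationalSeries_upperSet hc hDU)).coe_mul
    (Polynomial.X ^ e)
  rw [h1, add_sub_cancel_right] at h2
  simpa using h2

/-- The union is made disjoint by removing from each new translate the union of the others already
treated. That union absorbs `range g`, as the set `B` of the previous lemma must. -/
theorem isRationalSeries_biUnion_translate (hc : ∀ i, 0 < c i)
    (hg : ∀ z, φ (g z) = ∑ i, (c i : ℤ) * z i) (F : Finset M) (hF : ∀ u ∈ F, 0 ≤ φ u)
    (hfin : HasFiniteFibers φ (⋃ u ∈ F, range (fun z => u + g z))) :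
    IsRationalSeries (weightSeries φ (⋃ u ∈ F, range (fun z => u + g z))) := by
  classical
  induction F using Finset.induction_on with
  | empty => simpa using IsRationalSeries.coe 0
  | insert a F _ ih =>
    rw [Finset.set_biUnion_insert, ← sdiff_union_self] at hfin ⊢
    rw [weightSeries_union (hfin.mono subset_union_left) (hfin.mono subset_union_right)
      disjoint_sdiff_left]
    refine .add (isRationalSeries_translate_sdiff hc hg (hF a (Finset.mem_insert_self _ _)) ?_)
      (ih (fun u hu => hF u (Finset.mem_insert_of_mem hu)) (hfin.mono subset_union_right))
    simp only [mem_iUnion, mem_range]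
    rintro _ ⟨u, hu, z, rfl⟩ y
    exact ⟨u, hu, z + y, by rw [map_add, add_assoc]⟩

/-- `s` is a finite union of translates of one finitely generated submonoid. -/
def IsTranslateUnion (s : Set M) : Prop :=
  ∃ (F : Finset M) (P : AddSubmonoid M), P.FG ∧ ∀ x, x ∈ s ↔ ∃ u ∈ F, ∃ p ∈ P, u + p = x

theorem IsTranslateUnion.isRationalSeries [IsAddTorsionFree M] {s : Set M}
    (hs : IsTranslateUnion s) (h0 : ∀ x ∈ s, 0 ≤ φ x) (hfin : HasFiniteFibers φ s) :
    IsRationalSeries (weightSeries φ s) := by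
  classical
  obtain ⟨F, P, ⟨T, rfl⟩, hs⟩ := hs
  rcases F.eq_empty_or_nonempty with rfl | ⟨u, hu⟩
  · have : s = ∅ := by
      rw [eq_empty_iff_forall_notMem]
      intro x hx
      simp [hs] at hx
    simpa [this] using IsRationalSeries.coe 0
  -- Along the ray `u + k • t` inside `s`, a negative `φ t` would eventually make the weight
  -- negative, while `φ t = 0` would put infinitely many points (`M` is torsion-free) in one fibre.
  have hpos : ∀ t ∈ T.erase 0, 0 < φ t := by
    intro t ht
    rw [Finset.mem_erase] at ht
    have hmem : ∀ k : ℕ, u + k • t ∈ s := fun k => (hs _).2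
      ⟨u, hu, k • t, nsmul_mem (AddSubmonoid.subset_closure ht.2) k, rfl⟩
    have hval : ∀ k : ℕ, φ (u + k • t) = φ u + k * φ t := fun k => by simp
    have hu0 := h0 _ (hmem 0)
    rw [zero_smul, add_zero] at hu0
    rcases lt_trichotomy (φ t) 0 with h | h | h
    · have := h0 _ (hmem ((φ u).toNat + 1))
      rw [hval] at this
      push_cast [Int.toNat_of_nonneg hu0] at this
      nlinarith
    · refine absurd (hfin (φ u).toNat) ?_
      refine (infinite_range_of_injective (f := fun k : ℕ => u + k • t) ?_).mono ?_
      · intro k l hkl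
        have h1 : ((k : ℤ) - l) • t = 0 := by
          rw [sub_smul, natCast_zsmul, natCast_zsmul, sub_eq_zero]
          exact add_left_cancel hkl
        have h2 := (IsAddTorsionFree.zsmul_eq_zero_iff_left ht.1).1 h1
        omega
      · rintro _ ⟨k, rfl⟩
        exact ⟨hmem k, by rw [hval, h, Int.toNat_of_nonneg hu0]; simp⟩
    · exact h
  let e := (T.erase 0).equivFin
  let t : Fin (T.erase 0).card → M := fun i => (e.symm i : M)
  let g : (Fin (T.erase 0).card → ℕ) →+ M :=
    { toFun := fun z => ∑ i, z i • t i
      map_zero' := by simp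
      map_add' := fun y z => by simp [add_smul, Finset.sum_add_distrib] }
  have hrange : range t = (T : Set M) \ {0} := by
    have : t = Subtype.val ∘ e.symm := rfl
    rw [this, EquivLike.range_comp]
    ext x
    simp [and_comm]
  have hmem : ∀ x, x ∈ AddSubmonoid.closure (T : Set M) ↔ ∃ z, g z = x := by
    intro x
    have h1 : AddSubmonoid.closure (T : Set M) = AddSubmonoid.closure (range t) := by
      rw [hrange]
      refine le_antisymm (AddSubmonoid.closure_le.2 fun y hy => ?_)
        (AddSubmonoid.closure_mono sdiff_subset)
      by_cases h : y = 0
      · rw [h]; exact zero_mem _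
      · exact AddSubmonoid.subset_closure ⟨hy, h⟩
    rw [h1, AddSubmonoid.mem_closure_range_iff_of_fintype]
    exact ⟨fun ⟨z, hz⟩ => ⟨z, hz.symm⟩, fun ⟨z, hz⟩ => ⟨z, hz.symm⟩⟩
  have hpos' : ∀ i, 0 < φ (t i) := fun i => hpos _ (e.symm i).2
  have hS : s = ⋃ u ∈ F, range (fun z => u + g z) := by
    ext x
    simp only [hs, hmem, mem_iUnion, mem_range, exists_prop]
    constructor
    · rintro ⟨u, hu, _, ⟨z, rfl⟩, rfl⟩
      exact ⟨u, hu, z, rfl⟩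
    · rintro ⟨u, hu, z, rfl⟩
      exact ⟨u, hu, _, ⟨z, rfl⟩, rfl⟩
  rw [hS] at hfin ⊢
  refine isRationalSeries_biUnion_translate (c := fun i => (φ (t i)).toNat)
    (fun i => by simpa using hpos' i) (fun z => ?_) F (fun u hu => ?_) hfin
  · simp only [g, AddMonoidHom.coe_mk, ZeroHom.coe_mk, map_sum, map_nsmul, nsmul_eq_mul]
    refine Finset.sum_congr rfl fun i _ => ?_
    rw [Int.toNat_of_nonneg (hpos' i).le, mul_comm]
  · exact h0 u ((hs u).2 ⟨u, hu, 0, zero_mem _, add_zero u⟩)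

/-- Points of the intersection come from solutions of `u + f y = u' + f' y'`. By Dickson's lemma
there are finitely many minimal solutions, and every solution is a minimal one plus an element of
the homogeneous solution monoid `K`. Subtractivity makes `K` finitely generated. As `K` does not
depend on `u` and `u'`, one submonoid serves all translates. -/
theorem IsTranslateUnion.inter {s s' : Set M} (hs : IsTranslateUnion s)
    (hs' : IsTranslateUnion s') : IsTranslateUnion (s ∩ s') := by
  classical
  obtain ⟨F, P, hP, hs⟩ := hs
  obtain ⟨F', P', hP', hs'⟩ := hs'
  obtain ⟨m, f, rfl⟩ := AddSubmonoid.fg_iff_exists_fin_addMonoidHom.1 hP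
  obtain ⟨m', f', rfl⟩ := AddSubmonoid.fg_iff_exists_fin_addMonoidHom.1 hP'
  let E (u u' : M) : Set ((Fin m → ℕ) × (Fin m' → ℕ)) := {z | u + f z.1 = u' + f' z.2}
  have hE : ∀ u u', {z | Minimal (· ∈ E u u') z}.Finite := fun u u' =>
    WellQuasiOrderedLE.finite_of_isAntichain (setOfPred_minimal_antichain _)
  let K : AddSubmonoid ((Fin m → ℕ) × (Fin m' → ℕ)) :=
    { carrier := {z | f z.1 = f' z.2}
      zero_mem' := by simp
      add_mem' := fun {y z} hy hz => by
        simp only [mem_ofPred_eq, Prod.fst_add, Prod.snd_add, map_add] at *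
        rw [hy, hz] }
  have hK : K.FG := by
    refine AddSubmonoid.fg_of_subtractive ?_
    intro y hy z hz
    have hy' : f y.1 = f' y.2 := hy
    have hz' : f (y + z).1 = f' (y + z).2 := hz
    rw [Prod.fst_add, Prod.snd_add, map_add, map_add, hy'] at hz'
    exact add_left_cancel hz'
  let q : (Fin m → ℕ) × (Fin m' → ℕ) →+ M := f.comp (AddMonoidHom.fst _ _)
  refine ⟨F.biUnion fun u => F'.biUnion fun u' => (hE u u').toFinset.image fun z => u + f z.1,
    K.map q, hK.map q, fun x => ?_⟩
  rw [mem_inter_iff, hs, hs']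
  simp only [AddMonoidHom.mem_mrange, Finset.mem_biUnion, Finset.mem_image, Finite.mem_toFinset,
    AddSubmonoid.mem_map]
  constructor
  · rintro ⟨⟨u, hu, _, ⟨y, rfl⟩, rfl⟩, ⟨u', hu', _, ⟨y', rfl⟩, h⟩⟩
    have hmem : (y, y') ∈ E u u' := h.symm
    obtain ⟨v, hv, hmin⟩ := (isPWO_of_wellQuasiOrderedLE (E u u')).exists_le_minimal hmem
    obtain ⟨d, hd⟩ := exists_add_of_le hv
    have h1 : y = v.1 + d.1 := congrArg Prod.fst hd
    have h2 : y' = v.2 + d.2 := congrArg Prod.snd hd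
    have hvE : u + f v.1 = u' + f' v.2 := hmin.1
    refine ⟨u + f v.1, ⟨u, hu, u', hu', v, hmin, rfl⟩, f d.1, ⟨d, ?_, rfl⟩, ?_⟩
    · rw [h1, h2, map_add, map_add, ← add_assoc, ← add_assoc, hvE] at h
      exact (add_left_cancel h).symm
    · rw [h1, map_add, add_assoc]
  · rintro ⟨_, ⟨u, hu, u', hu', v, hmin, rfl⟩, _, ⟨d, hd, rfl⟩, rfl⟩
    have hvE : u + f v.1 = u' + f' v.2 := hmin.1
    have hd' : f d.1 = f' d.2 := hd
    refine ⟨⟨u, hu, _, ⟨v.1 + d.1, rfl⟩, ?_⟩, ⟨u', hu', _, ⟨v.2 + d.2, rfl⟩, ?_⟩⟩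
    · rw [map_add, add_assoc]; rfl
    · rw [map_add, ← add_assoc, ← hvE, ← hd']; rfl

/-- The weight series of a semilinear set is rational. -/
theorem isRationalSeries_of_isSemilinearSet [IsAddTorsionFree M] {s : Set M}
    (hs : IsSemilinearSet s) (h0 : ∀ x ∈ s, 0 ≤ φ x) (hfin : HasFiniteFibers φ s) :
    IsRationalSeries (weightSeries φ s) := by
  obtain ⟨S, hS, rfl⟩ := isSemilinearSet_iff.1 hs
  rw [sUnion_eq_biUnion] at h0 hfin ⊢
  -- Containment in the whole union is built into the class so that its members inherit nonnegative
  -- weights and finite fibres.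
  refine isRationalSeries_biUnion (C := {a | IsTranslateUnion a ∧ a ⊆ ⋃ t ∈ S, t}) ?_ ?_ ?_ S id ?_
  · rintro a ⟨ha, ha'⟩ b ⟨hb, -⟩
    exact ⟨ha.inter hb, inter_subset_left.trans ha'⟩
  · rintro a ⟨-, ha⟩
    exact hfin.mono ha
  · rintro a ⟨ha, ha'⟩
    exact ha.isRationalSeries (fun x hx => h0 x (ha' hx)) (hfin.mono ha')
  · intro t ht
    refine ⟨?_, subset_biUnion_of_mem (u := fun t => t) ht⟩
    obtain ⟨a, P, hP, h⟩ := isLinearSet_iff_exists_fg_eq_vadd.1 (hS t ht)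
    refine ⟨{a}, P, hP, fun x => ?_⟩
    simp [h, mem_vadd_set]

end monoid

/-! ### The inversion formula for the Coxeter length. -/

theorem ediv_eq_of_bounds {n x q : ℤ} (h1 : n * q ≤ x) (h2 : x < n * q + n) : x / n = q := by
  have hn : 0 < n := by linarith
  refine le_antisymm (Int.lt_add_one_iff.1 ?_) ?_
  · rw [Int.ediv_lt_iff_lt_mul hn]
    linarith
  · rw [Int.le_ediv_iff_mul_le hn]
    linarith

theorem sub_one_ediv {n x : ℤ} (hn : 0 < n) (h : ¬ n ∣ x) : (x - 1) / n = x / n := by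
  have h1 := Int.emod_nonneg x hn.ne'
  have h2 := Int.emod_lt_of_pos x hn
  have h3 := Int.emod_add_mul_ediv x n
  have h4 : x % n ≠ 0 := fun h' => h (Int.dvd_of_emod_eq_zero h')
  exact ediv_eq_of_bounds (by omega) (by omega)

theorem add_one_ediv {n x : ℤ} (hn : 0 < n) (h : ¬ n ∣ x + 1) : (x + 1) / n = x / n := by
  rw [← sub_one_ediv hn h, add_sub_cancel_right]

theorem neg_ediv_of_not_dvd {n x : ℤ} (hn : 0 < n) (h : ¬ n ∣ x) : -x / n = -(x / n) - 1 := by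
  have h1 := Int.emod_nonneg x hn.ne'
  have h2 := Int.emod_lt_of_pos x hn
  have h3 := Int.emod_add_mul_ediv x n
  have h4 : x % n ≠ 0 := fun h' => h (Int.dvd_of_emod_eq_zero h')
  refine ediv_eq_of_bounds ?_ ?_ <;> rw [mul_sub, mul_neg] <;> omega

/-- Twice the number of inversions of `w` modulo simultaneous translation by `n`: the residue
classes of `i` and `j` contribute the difference of the floors of `(w j - w i) / n` and
`(j - i) / n`. -/
noncomputable def doubleInversions (n : ℕ) (w : AffineSymmetricGroup n) : ℤ :=
  ∑ i ∈ Finset.Icc (1 : ℤ) n, ∑ j ∈ Finset.Icc (1 : ℤ) n,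
    |((w : Equiv.Perm ℤ) j - (w : Equiv.Perm ℤ) i) / n - (j - i) / n|

section length

variable {n : ℕ}

theorem doubleInversions_nonneg (w : AffineSymmetricGroup n) : 0 ≤ doubleInversions n w :=
  Finset.sum_nonneg fun _ _ => Finset.sum_nonneg fun _ _ => abs_nonneg _

theorem doubleInversions_one : doubleInversions n 1 = 0 := by
  simp [doubleInversions]

theorem apply_eq_add (w : AffineSymmetricGroup n) {i j : ℤ} (h : (n : ℤ) ∣ j - i) :
    (w : Equiv.Perm ℤ) j = (w : Equiv.Perm ℤ) i + (j - i) := by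
  obtain ⟨t, ht⟩ := h
  rw [show j = i + n * t by linarith, map_add_mul w.2.1]
  ring

theorem dvd_of_dvd_apply_sub (w : AffineSymmetricGroup n) {i j : ℤ}
    (h : (n : ℤ) ∣ (w : Equiv.Perm ℤ) j - (w : Equiv.Perm ℤ) i) : (n : ℤ) ∣ j - i := by
  obtain ⟨t, ht⟩ := h
  have h1 := map_add_mul w.2.1 i t
  have h2 := (w : Equiv.Perm ℤ).injective (h1.trans (by linarith : _ = (w : Equiv.Perm ℤ) j))
  exact ⟨t, by linarith⟩

/-- Shifting `i` or `j` by `n` changes both floors equally, so a summand depends only on residues,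
and `v` permutes these. This puts the sum for `w` in a form comparable term by term with that for `w
* v`. -/
theorem sum_doubleInversions_comp (w v : AffineSymmetricGroup n) :
    ∑ i ∈ Finset.Icc (1 : ℤ) n, ∑ j ∈ Finset.Icc (1 : ℤ) n,
      |((w : Equiv.Perm ℤ) ((v : Equiv.Perm ℤ) j) - (w : Equiv.Perm ℤ) ((v : Equiv.Perm ℤ) i)) / n -
        ((v : Equiv.Perm ℤ) j - (v : Equiv.Perm ℤ) i) / n| = doubleInversions n w := by
  rcases Nat.eq_zero_or_pos n with rfl | hn
  · simp [doubleInversions]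
  have hn' : (n : ℤ) ≠ 0 := by omega
  have e1 : ∀ x y : ℤ, (x + n - y) / n = (x - y) / n + 1 := fun x y => by
    rw [show x + n - y = x - y + n by ring, Int.add_ediv_of_dvd_right dvd_rfl, Int.ediv_self hn']
  have e2 : ∀ x y : ℤ, (x - (y + n)) / n = (x - y) / n - 1 := fun x y => by
    rw [show x - (y + n) = x - y - n by ring, Int.sub_ediv_of_dvd _ dvd_rfl, Int.ediv_self hn']
  rw [sum_comp v.2.1 (fun i => ∑ j ∈ Finset.Icc (1 : ℤ) n,
      |((w : Equiv.Perm ℤ) ((v : Equiv.Perm ℤ) j) - (w : Equiv.Perm ℤ) i) / n -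
        ((v : Equiv.Perm ℤ) j - i) / n|)]
  · exact Finset.sum_congr rfl fun i _ => sum_comp v.2.1
      (fun j => |((w : Equiv.Perm ℤ) j - (w : Equiv.Perm ℤ) i) / n - (j - i) / n|)
      fun j => by rw [w.2.1, e1, e1, add_sub_add_right_eq_sub]
  · intro i
    simp only [w.2.1, e2, sub_sub_sub_cancel_right]

/-- Multiplication by an adjacent transposition changes the number of inversions by one, according
to whether it creates or removes a descent. -/
theorem doubleInversions_mul (hn : 2 ≤ n) (w s : AffineSymmetricGroup n) (a : ℤ)
    (hs : ∀ j : ℤ, (s : Equiv.Perm ℤ) j =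
      if (n : ℤ) ∣ j - a then j + 1 else if (n : ℤ) ∣ j - (a + 1) then j - 1 else j) :
    doubleInversions n (w * s) = doubleInversions n w +
      if (w : Equiv.Perm ℤ) a < (w : Equiv.Perm ℤ) (a + 1) then 2 else -2 := by
  have hn' : (0 : ℤ) < n := by omega
  set d := (w : Equiv.Perm ℤ) (a + 1) - (w : Equiv.Perm ℤ) a with hd
  have hnd : ¬ (n : ℤ) ∣ d := fun h => by
    have := Int.le_of_dvd (by norm_num) (dvd_of_dvd_apply_sub w h)
    omega
  set δ : ℤ := if (w : Equiv.Perm ℤ) a < (w : Equiv.Perm ℤ) (a + 1) then 1 else -1 with hδ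
  -- Since `n ∤ d`, the floor of `d / n` is nonnegative at an ascent and at most `-1` at a descent.
  have hδq : |d / n + 1| - |d / n| = δ := by
    rw [hδ]
    split_ifs with h
    · have : 0 ≤ d / n := Int.ediv_nonneg (by omega) hn'.le
      rw [abs_of_nonneg this, abs_of_nonneg (by omega)]
      ring
    · have h0 : d ≠ 0 := fun h => hnd (h ▸ dvd_zero _)
      have : d / n < 0 := Int.ediv_neg_of_neg_of_pos (by omega) hn'
      rw [abs_of_neg this, abs_of_nonpos (by omega)]
      ring
  have e1 : ∀ t : ℤ, (1 + n * t) / n = t := fun t =>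
    ediv_eq_of_bounds (by omega) (by omega)
  have e2 : ∀ t : ℤ, (-1 + n * t) / n = t - 1 := fun t =>
    ediv_eq_of_bounds (by rw [mul_sub]; omega) (by rw [mul_sub]; omega)
  have e3 : ∀ x t : ℤ, (x + n * t) / n = x / n + t := fun x t =>
    Int.add_mul_ediv_left _ _ hn'.ne'
  -- Replacing `⌊(s j - s i)/n⌋` by `⌊(j - i)/n⌋` matters only when `(i, j)` is congruent to `(a, a
  -- + 1)` or `(a + 1, a)`. Each of these two residue pairs contributes `δ`, hence the total change
  -- `±2`.
  have key : ∀ i j : ℤ,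
      |((w : Equiv.Perm ℤ) ((s : Equiv.Perm ℤ) j) - (w : Equiv.Perm ℤ) ((s : Equiv.Perm ℤ) i)) / n -
        (j - i) / n| =
      |((w : Equiv.Perm ℤ) ((s : Equiv.Perm ℤ) j) - (w : Equiv.Perm ℤ) ((s : Equiv.Perm ℤ) i)) / n -
        ((s : Equiv.Perm ℤ) j - (s : Equiv.Perm ℤ) i) / n| +
      ((if (n : ℤ) ∣ i - a then (if (n : ℤ) ∣ j - (a + 1) then δ else 0) else 0) +
        (if (n : ℤ) ∣ i - (a + 1) then (if (n : ℤ) ∣ j - a then δ else 0) else 0)) := by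
    intro i j
    have hex : ∀ x : ℤ, (n : ℤ) ∣ x - a → ¬ (n : ℤ) ∣ x - (a + 1) :=
      fun x h h' => not_dvd_both hn h h'
    by_cases hi : (n : ℤ) ∣ i - a
    · have hi' := hex i hi
      by_cases hj : (n : ℤ) ∣ j - a
      · have hj' := hex j hj
        simp only [hs, hi, hj, hi', hj', if_true, if_false, add_sub_add_right_eq_sub, add_zero]
      by_cases hj' : (n : ℤ) ∣ j - (a + 1)
      · obtain ⟨t, ht⟩ := dvd_sub hj' hi
        have w1 := apply_eq_add w (show (n : ℤ) ∣ i + 1 - (a + 1) by simpa using hi)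
        have w2 := apply_eq_add w (show (n : ℤ) ∣ j - 1 - a by
          rwa [show j - 1 - a = j - (a + 1) by ring])
        simp only [hs, hi, hj, hi', hj', if_true, if_false, add_zero]
        rw [w1, w2, show (w : Equiv.Perm ℤ) a + (j - 1 - a) -
          ((w : Equiv.Perm ℤ) (a + 1) + (i + 1 - (a + 1))) = -d + n * t by rw [hd]; linarith,
          show j - i = 1 + n * t by linarith, show j - 1 - (i + 1) = -1 + n * t by linarith, e1, e2,
          e3, neg_ediv_of_not_dvd hn' hnd, ← hδq,
          show -(d / n) - 1 + t - t = -(d / n + 1) by ring,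
          show -(d / n) - 1 + t - (t - 1) = -(d / n) by ring, abs_neg, abs_neg]
        ring
      · simp only [hs, hi, hj, hi', hj', if_true, if_false, add_zero]
        rw [show j - (i + 1) = j - i - 1 by ring, sub_one_ediv hn' fun h => hj (by
          simpa using dvd_add h hi)]
    by_cases hi' : (n : ℤ) ∣ i - (a + 1)
    · by_cases hj : (n : ℤ) ∣ j - a
      · have hj' := hex j hj
        obtain ⟨t, ht⟩ := dvd_sub hj hi'
        have w1 := apply_eq_add w (show (n : ℤ) ∣ j + 1 - (a + 1) by simpa using hj)
        have w2 := apply_eq_add w (show (n : ℤ) ∣ i - 1 - a by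
          rwa [show i - 1 - a = i - (a + 1) by ring])
        simp only [hs, hi, hj, hi', hj', if_true, if_false, zero_add]
        rw [w1, w2, show (w : Equiv.Perm ℤ) (a + 1) + (j + 1 - (a + 1)) -
          ((w : Equiv.Perm ℤ) a + (i - 1 - a)) = d + n * t by rw [hd]; linarith,
          show j - i = -1 + n * t by linarith, show j + 1 - (i - 1) = 1 + n * t by linarith, e1, e2,
          e3, ← hδq, add_sub_cancel_right, show d / n + t - (t - 1) = d / n + 1 by ring]
        ring
      by_cases hj' : (n : ℤ) ∣ j - (a + 1)
      · simp only [hs, hi, hj, hi', hj', if_true, if_false, sub_sub_sub_cancel_right, add_zero]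
      · simp only [hs, hi, hj, hi', hj', if_true, if_false, add_zero]
        rw [show j - (i - 1) = j - i + 1 by ring, add_one_ediv hn' fun h => hj (by
          have := dvd_add h hi'
          rwa [show j - i + 1 + (i - (a + 1)) = j - a by ring] at this)]
    by_cases hj : (n : ℤ) ∣ j - a
    · simp only [hs, hi, hj, hi', if_true, if_false, add_zero]
      rw [show j + 1 - i = j - i + 1 by ring, add_one_ediv hn' fun h => hi' (by
        have := dvd_sub hj h
        rwa [show j - a - (j - i + 1) = i - (a + 1) by ring] at this)]
    by_cases hj' : (n : ℤ) ∣ j - (a + 1)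
    · simp only [hs, hi, hj, hi', hj', if_true, if_false, add_zero]
      rw [show j - 1 - i = j - i - 1 by ring, sub_one_ediv hn' fun h => hi' (by
        have := dvd_sub hj' h
        rwa [show j - (a + 1) - (j - i) = i - (a + 1) by ring] at this)]
    · simp only [hs, hi, hj, hi', hj', if_false, add_zero]
  have hsum : ∀ b c : ℤ, ∑ i ∈ Finset.Icc (1 : ℤ) n, ∑ j ∈ Finset.Icc (1 : ℤ) n,
      (if (n : ℤ) ∣ i - b then (if (n : ℤ) ∣ j - c then δ else 0) else 0) = δ := by
    intro b c
    rw [← sum_ite_dvd (show 0 < n by omega) b δ]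
    refine Finset.sum_congr rfl fun i _ => ?_
    split_ifs
    · rw [sum_ite_dvd (by omega), sum_ite_dvd (by omega)]
    · simp
  rw [← sum_doubleInversions_comp w s, doubleInversions]
  simp only [Subgroup.coe_mul, Equiv.Perm.mul_apply, key, Finset.sum_add_distrib, hsum]
  rw [hδ]
  split_ifs <;> ring

theorem adjacentTransposition_mul_self (hn : 2 ≤ n) {s : AffineSymmetricGroup n} {i : ℤ}
    (hs : ∀ j : ℤ, (s : Equiv.Perm ℤ) j =
      if (n : ℤ) ∣ j - i then j + 1 else if (n : ℤ) ∣ j - (i + 1) then j - 1 else j) :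
    s * s = 1 := by
  ext j
  simp only [Subgroup.coe_mul, Equiv.Perm.mul_apply, OneMemClass.coe_one, Equiv.Perm.one_apply]
  rw [hs j]
  by_cases h1 : (n : ℤ) ∣ j - i
  · have h2 : (n : ℤ) ∣ j + 1 - (i + 1) := by simpa using h1
    rw [if_pos h1, hs, if_neg (fun h => not_dvd_both hn h h2), if_pos h2]; ring
  · rw [if_neg h1]
    by_cases h2 : (n : ℤ) ∣ j - (i + 1)
    · rw [if_pos h2, hs, if_pos (by rwa [show j - 1 - i = j - (i + 1) by ring])]; ring
    · rw [if_neg h2, hs, if_neg h1, if_neg h2]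

theorem doubleInversions_prod_le (hn : 2 ≤ n) (l : List (AffineSymmetricGroup n))
    (hl : ∀ s ∈ l, IsAdjacentTransposition n s) : doubleInversions n l.prod ≤ 2 * l.length := by
  induction l using List.reverseRecOn with
  | nil => simp [doubleInversions_one]
  | append_singleton l s ih =>
    obtain ⟨a, ha⟩ := hl s (by simp)
    have := ih fun r hr => hl r (by simp [hr])
    rw [List.prod_append, List.prod_singleton, doubleInversions_mul hn _ _ a ha]
    push_cast [List.length_append, List.length_singleton]
    split_ifs <;> linarith

/-- Sorting: multiplying at a descent lowers the sum by `2`, and an element without descents is the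
identity. -/
theorem exists_word_of_doubleInversions (hn : 2 ≤ n) (w : AffineSymmetricGroup n) :
    ∃ l : List (AffineSymmetricGroup n), (∀ s ∈ l, IsAdjacentTransposition n s) ∧
      (2 * l.length : ℤ) = doubleInversions n w ∧ l.prod = w := by
  induction h : (doubleInversions n w).toNat using Nat.strong_induction_on generalizing w with
  | _ N ih =>
    by_cases hd : ∀ i : ℤ, (w : Equiv.Perm ℤ) i < (w : Equiv.Perm ℤ) (i + 1)
    · rw [eq_one_of_no_descent hn w hd]
      exact ⟨[], by simp, by simp [doubleInversions_one], by simp⟩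
    push Not at hd
    obtain ⟨a, ha⟩ := hd
    obtain ⟨s, hs⟩ := exists_adjacentTransposition hn a
    have hmul := doubleInversions_mul hn w s a hs
    rw [if_neg ha.not_gt] at hmul
    have h0 := doubleInversions_nonneg (w * s)
    obtain ⟨l, hl, hlen, hprod⟩ := ih _ (by omega) (w * s) rfl
    refine ⟨l ++ [s], ?_, ?_, ?_⟩
    · intro r hr
      rcases List.mem_append.1 hr with h | h
      · exact hl r h
      · rw [List.mem_singleton.1 h]; exact ⟨a, hs⟩
    · push_cast [List.length_append, List.length_singleton]
      linarith
    · simp [hprod, mul_assoc, adjacentTransposition_mul_self hn hs]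

/-- A letter raises the sum by at most `2`, so no word is shorter than the sorting word. -/
theorem two_mul_coxeterLength (hn : 2 ≤ n) (w : AffineSymmetricGroup n) :
    (2 * coxeterLength n w : ℤ) = doubleInversions n w := by
  obtain ⟨l, hl, hlen, hprod⟩ := exists_word_of_doubleInversions hn w
  have hmem : l.length ∈ {m : ℕ | ∃ l : List (AffineSymmetricGroup n),
    (∀ s ∈ l, IsAdjacentTransposition n s) ∧ l.length = m ∧ l.prod = w} := ⟨l, hl, rfl, hprod⟩
  have h1 : coxeterLength n w ≤ l.length := Nat.sInf_le hmem
  obtain ⟨l', hl', hlen', hprod'⟩ := Nat.sInf_mem ⟨_, hmem⟩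
  have h2 := doubleInversions_prod_le hn l' hl'
  rw [hprod', hlen'] at h2
  change _ ≤ 2 * ((coxeterLength n w : ℕ) : ℤ) at h2
  omega

end length

/-! ### Semilinearity of linear equations, inequalities, divisibility and floors. -/

section semilinear

variable {M : Type*} [AddCommGroup M] [AddMonoid.FG M] {f g : M → ℤ}

theorem isSemilinearSet_eq (hf : ∀ x y, f (x + y) = f x + f y) (c : ℤ) :
    IsSemilinearSet {x | f x = c} := by
  convert! isSemilinearSet_setOfPred_eq (M := M) 0 c (AddMonoidHom.mk' f hf) (0 : M →+ ℤ) using 2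
  simp

theorem isSemilinearSet_le (hf : ∀ x y, f (x + y) = f x + f y) (c : ℤ) :
    IsSemilinearSet {x | c ≤ f x} := by
  -- A slack variable in `ℕ` turns the inequality into an equation, and is then projected away.
  have h := (isSemilinearSet_setOfPred_eq (M := M × ℕ) 0 c
    ((AddMonoidHom.mk' f hf).comp (AddMonoidHom.fst M ℕ))
    ((Nat.castAddMonoidHom ℤ).comp (AddMonoidHom.snd M ℕ))).image (AddMonoidHom.fst M ℕ)
  convert! h using 1
  ext x
  constructor
  · intro hx
    have hx' : c ≤ f x := hx
    refine ⟨(x, (f x - c).toNat), ?_, rfl⟩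
    change 0 + f x = c + (((f x - c).toNat : ℕ) : ℤ)
    omega
  · rintro ⟨⟨y, k⟩, hy, rfl⟩
    have hy' : 0 + f y = c + (k : ℤ) := hy
    change c ≤ f y
    omega

theorem isSemilinearSet_exists {L N : Type*} [AddCommGroup L] [AddCommGroup N] {E : Set (L × N)}
    (hE : IsSemilinearSet E) : IsSemilinearSet {x | ∃ y, (x, y) ∈ E} := by
  convert! hE.image (AddMonoidHom.fst L N) using 1
  ext x
  simp

theorem isSemilinearSet_dvd (hf : ∀ x y, f (x + y) = f x + f y) (n : ℤ) :
    IsSemilinearSet {x | n ∣ f x} := by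
  have h : IsSemilinearSet {z : M × ℤ | f z.1 - n * z.2 = 0} :=
    isSemilinearSet_eq (fun x y => by simp only [Prod.fst_add, Prod.snd_add, hf]; ring) 0
  convert! isSemilinearSet_exists h using 1
  ext x
  simp only [mem_ofPred_eq, sub_eq_zero]
  exact Iff.rfl

/-- The graph of `|⌊f / n⌋ - c|` is semilinear. -/
theorem isSemilinearSet_eq_abs_ediv_sub (hf : ∀ x y, f (x + y) = f x + f y)
    (hg : ∀ x y, g (x + y) = g x + g y) {n : ℤ} (hn : 0 < n) (c : ℤ) :
    IsSemilinearSet {x | g x = |f x / n - c|} := by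
  -- The extra coordinate `z.2` is the quotient `q`, pinned down by `n * q ≤ f ≤ n * q + n - 1`; the
  -- absolute value becomes `g ≥ 0` together with `g = q - c` or `g = c - q`.
  have h1 : IsSemilinearSet {z : M × ℤ | 0 ≤ f z.1 - n * z.2} :=
    isSemilinearSet_le (fun x y => by simp only [Prod.fst_add, Prod.snd_add, hf]; ring) 0
  have h2 : IsSemilinearSet {z : M × ℤ | 1 - n ≤ n * z.2 - f z.1} :=
    isSemilinearSet_le (fun x y => by simp only [Prod.fst_add, Prod.snd_add, hf]; ring) _
  have h3 : IsSemilinearSet {z : M × ℤ | 0 ≤ g z.1} :=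
    isSemilinearSet_le (fun x y => by simp only [Prod.fst_add, hg]) _
  have h4 : IsSemilinearSet {z : M × ℤ | g z.1 - z.2 = -c} :=
    isSemilinearSet_eq (fun x y => by simp only [Prod.fst_add, Prod.snd_add, hg]; ring) _
  have h5 : IsSemilinearSet {z : M × ℤ | g z.1 + z.2 = c} :=
    isSemilinearSet_eq (fun x y => by simp only [Prod.fst_add, Prod.snd_add, hg]; ring) _
  convert! isSemilinearSet_exists ((h1.inter h2).inter (h3.inter (h4.union h5))) using 1
  ext x
  simp only [mem_inter_iff, mem_union, mem_ofPred_eq]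
  constructor
  · intro h
    have e1 := Int.emod_nonneg (f x) hn.ne'
    have e2 := Int.emod_lt_of_pos (f x) hn
    have e3 := Int.emod_add_mul_ediv (f x) n
    refine ⟨f x / n, ⟨by linarith, by linarith⟩, by rw [h]; exact abs_nonneg _, ?_⟩
    rcases abs_choice (f x / n - c) with h' | h' <;> rw [h, h']
    · left; ring
    · right; ring
  · rintro ⟨q, ⟨e1, e2⟩, e3, e4⟩
    rw [ediv_eq_of_bounds (q := q) (by linarith) (by linarith)]
    rcases e4 with e4 | e4
    · rw [abs_of_nonneg] <;> linarith
    · rw [abs_of_nonpos] <;> linarith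

end semilinear

/-! ### Windows and their description by linear arithmetic. -/

section window

variable {n : ℕ}

/-- The window `w 1, …, w n`. -/
def window (w : AffineSymmetricGroup n) (i : Fin n) : ℤ := (w : Equiv.Perm ℤ) (i + 1)

theorem sum_Icc_eq_sum_fin (f : ℤ → ℤ) :
    ∑ i ∈ Finset.Icc (1 : ℤ) n, f i = ∑ i : Fin n, f (i + 1) := by
  have h : Finset.Icc (1 : ℤ) n = Finset.univ.image (fun i : Fin n => (i : ℤ) + 1) := by
    ext x
    simp only [Finset.mem_Icc, Finset.mem_image, Finset.mem_univ, true_and]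
    constructor
    · intro hx
      exact ⟨⟨(x - 1).toNat, by omega⟩, by simp only; omega⟩
    · rintro ⟨i, rfl⟩
      have := i.2
      omega
  rw [h, Finset.sum_image fun i _ j _ hij => by
    ext
    omega]

theorem exists_fin_eq (hn : 0 < n) (i : ℤ) : ∃ (r : Fin n) (t : ℤ), i = r + 1 + n * t := by
  have hn' : (0 : ℤ) < n := by omega
  have h1 := Int.emod_nonneg (i - 1) hn'.ne'
  have h2 := Int.emod_lt_of_pos (i - 1) hn'
  have h3 := Int.emod_add_mul_ediv (i - 1) n
  exact ⟨⟨((i - 1) % n).toNat, by omega⟩, (i - 1) / n, by simp only; omega⟩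

theorem apply_fin_add_mul (w : AffineSymmetricGroup n) (r : Fin n) (t : ℤ) :
    (w : Equiv.Perm ℤ) (r + 1 + n * t) = window w r + n * t :=
  map_add_mul w.2.1 _ _

theorem window_injective (hn : 0 < n) :
    Function.Injective (window : AffineSymmetricGroup n → Fin n → ℤ) := by
  intro v w h
  ext i
  obtain ⟨r, t, rfl⟩ := exists_fin_eq hn i
  rw [apply_fin_add_mul, apply_fin_add_mul, h]

/-- The conditions on a window: correct sum, and distinct residues modulo `n`. -/
def IsWindow (n : ℕ) (x : Fin n → ℤ) : Prop :=
  ∑ i, x i = ∑ i ∈ Finset.Icc (1 : ℤ) n, i ∧ ∀ i j, i ≠ j → ¬ (n : ℤ) ∣ x j - x i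

theorem isWindow_window (w : AffineSymmetricGroup n) : IsWindow n (window w) := by
  refine ⟨?_, fun i j hij h => hij ?_⟩
  · rw [← w.2.2, sum_Icc_eq_sum_fin]
    rfl
  · obtain ⟨t, ht⟩ := dvd_of_dvd_apply_sub w h
    have h1 := i.2
    have h2 := j.2
    have h3 : t = 0 := by
      by_contra h3
      rcases lt_or_gt_of_ne h3 with h3 | h3 <;> nlinarith
    rw [h3] at ht
    ext
    omega

/-- Distinct residues make `Fin n → ZMod n` injective, hence bijective by counting, so the periodic
extension of `x` hits every integer exactly once. -/
theorem exists_window_eq (hn : 0 < n) {x : Fin n → ℤ} (hx : IsWindow n x) :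
    ∃ w : AffineSymmetricGroup n, window w = x := by
  have : NeZero n := ⟨hn.ne'⟩
  have hn' : (n : ℤ) ≠ 0 := by omega
  have hinj : Function.Injective (fun i : Fin n => (x i : ZMod n)) := by
    intro i j hij
    by_contra hne
    exact hx.2 i j hne ((ZMod.intCast_eq_intCast_iff_dvd_sub _ _ _).1 hij)
  have hbij := (Fintype.bijective_iff_injective_and_card _).2 ⟨hinj, by simp⟩
  choose r t hrt using exists_fin_eq hn
  let f : ℤ → ℤ := fun i => x (r i) + n * t i
  have huniq : ∀ (a b : Fin n) (s u : ℤ), (a : ℤ) + 1 + n * s = b + 1 + n * u → a = b ∧ s = u := by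
    intro a b s u h
    have h1 := a.2
    have h2 := b.2
    have h3 : s = u := by
      by_contra h3
      rcases lt_or_gt_of_ne h3 with h3 | h3 <;> nlinarith
    rw [h3] at h
    exact ⟨by ext; omega, h3⟩
  have hf : ∀ (a : Fin n) (s : ℤ), f (a + 1 + n * s) = x a + n * s := by
    intro a s
    obtain ⟨h1, h2⟩ := huniq _ _ _ _ (hrt (a + 1 + n * s))
    simp only [f, ← h1, ← h2]
  have hbij' : Function.Bijective f := by
    constructor
    · intro i j hij
      have h1 : x (r i) + n * t i = x (r j) + n * t j := hij
      have h2 : r i = r j := hinj ((ZMod.intCast_eq_intCast_iff_dvd_sub _ _ _).2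
        ⟨t i - t j, by linarith⟩)
      rw [h2] at h1
      have h3 : t i = t j := mul_left_cancel₀ hn' (add_left_cancel h1)
      rw [hrt i, hrt j, h2, h3]
    · intro y
      obtain ⟨a, ha⟩ := hbij.2 (y : ZMod n)
      obtain ⟨s, hs⟩ := (ZMod.intCast_eq_intCast_iff_dvd_sub _ _ _).1 ha
      exact ⟨a + 1 + n * s, by rw [hf]; linarith⟩
  refine ⟨⟨Equiv.ofBijective f hbij', ?_, ?_⟩, ?_⟩
  · intro i
    change f (i + n) = f i + n
    rw [show i + (n : ℤ) = r i + 1 + n * (t i + 1) by linarith [hrt i], hf]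
    simp only [f]
    ring
  · rw [← hx.1, sum_Icc_eq_sum_fin]
    exact Finset.sum_congr rfl fun i _ => by simpa using hf i 0
  · ext i
    simpa [window] using hf i 0

theorem isSemilinearSet_isWindow (n : ℕ) : IsSemilinearSet {x | IsWindow n x} := by
  have h1 : IsSemilinearSet {x : Fin n → ℤ | ∑ i, x i = ∑ i ∈ Finset.Icc (1 : ℤ) n, i} :=
    isSemilinearSet_eq (fun x y => by simp [Finset.sum_add_distrib]) _
  have h2 : ∀ i j, IsSemilinearSet {x : Fin n → ℤ | i ≠ j → ¬ (n : ℤ) ∣ x j - x i} := by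
    intro i j
    by_cases hij : i = j
    · simp [hij]
    · convert! (isSemilinearSet_dvd (f := fun x : Fin n → ℤ => x j - x i)
        (fun x y => by simp only [Pi.add_apply]; ring) n).compl using 1
      ext x
      simp [hij]
  convert! h1.inter (IsSemilinearSet.iInter fun i => IsSemilinearSet.iInter (h2 i)) using 1
  ext x
  simp [IsWindow]

theorem isSemilinearSet_doubleInversions (hn : 0 < n) :
    IsSemilinearSet {y : (Fin n → ℤ) × ℤ | 2 * y.2 =
      ∑ i : Fin n, ∑ j : Fin n, |(y.1 j - y.1 i) / n - ((j + 1 : ℤ) - (i + 1)) / n|} := by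
  have hn' : (0 : ℤ) < n := by omega
  -- One auxiliary integer `z.2 i j` stands for each absolute value, so that the sum becomes linear;
  -- these integers are projected away at the end.
  have h1 : ∀ i j : Fin n, IsSemilinearSet {z : ((Fin n → ℤ) × ℤ) × (Fin n → Fin n → ℤ) |
      z.2 i j = |(z.1.1 j - z.1.1 i) / n - ((j + 1 : ℤ) - (i + 1)) / n|} := fun i j =>
    isSemilinearSet_eq_abs_ediv_sub
      (f := fun z : ((Fin n → ℤ) × ℤ) × (Fin n → Fin n → ℤ) => z.1.1 j - z.1.1 i)
      (g := fun z : ((Fin n → ℤ) × ℤ) × (Fin n → Fin n → ℤ) => z.2 i j)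
      (fun x y => by simp only [Prod.fst_add, Pi.add_apply]; ring)
      (fun x y => by simp only [Prod.snd_add, Pi.add_apply]) hn' _
  have h2 : IsSemilinearSet {z : ((Fin n → ℤ) × ℤ) × (Fin n → Fin n → ℤ) |
      2 * z.1.2 - ∑ i, ∑ j, z.2 i j = 0} :=
    isSemilinearSet_eq (fun x y => by
      simp only [Prod.fst_add, Prod.snd_add, Pi.add_apply, Finset.sum_add_distrib]; ring) _
  convert! isSemilinearSet_exists
    (h2.inter (IsSemilinearSet.iInter fun i => IsSemilinearSet.iInter (h1 i))) using 1
  ext y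
  simp only [mem_inter_iff, mem_iInter, mem_ofPred_eq, sub_eq_zero]
  constructor
  · intro h
    exact ⟨fun i j => |(y.1 j - y.1 i) / n - ((j + 1 : ℤ) - (i + 1)) / n|, h, fun _ _ => rfl⟩
  · rintro ⟨a, h, ha⟩
    rw [h]
    exact Finset.sum_congr rfl fun i _ => Finset.sum_congr rfl fun j _ => ha i j

theorem doubleInversions_eq_window (w : AffineSymmetricGroup n) : doubleInversions n w =
    ∑ i : Fin n, ∑ j : Fin n, |(window w j - window w i) / n - ((j + 1 : ℤ) - (i + 1)) / n| := by
  rw [doubleInversions, sum_Icc_eq_sum_fin]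
  exact Finset.sum_congr rfl fun i _ => sum_Icc_eq_sum_fin _

theorem contains_iff_window (hn : 0 < n) {k : ℕ} (w : AffineSymmetricGroup n)
    (p : Equiv.Perm (Fin k)) : Contains w p ↔ ∃ (r : Fin k → Fin n) (t : Fin k → ℤ),
      (∀ a b, a < b → (r a + n * t a : ℤ) < r b + n * t b) ∧
      ∀ a b, window w (r a) + n * t a < window w (r b) + n * t b ↔ p a < p b := by
  constructor
  · rintro ⟨i, hi, h⟩
    choose r t hrt using fun a => exists_fin_eq hn (i a)
    refine ⟨r, t, fun a b hab => ?_, fun a b => ?_⟩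
    · have := hi hab
      rw [hrt a, hrt b] at this
      linarith
    · rw [← h a b, hrt a, hrt b, apply_fin_add_mul, apply_fin_add_mul]
  · rintro ⟨r, t, h1, h2⟩
    refine ⟨fun a => r a + 1 + n * t a, fun a b hab => ?_, fun a b => ?_⟩
    · have := h1 a b hab
      simp only
      linarith
    · rw [← h2 a b, apply_fin_add_mul, apply_fin_add_mul]

/-- The residues `r` range over a finite set, giving a finite union; the unbounded `t` is eliminated
by projection. -/
theorem isSemilinearSet_contains (n : ℕ) {k : ℕ} (p : Equiv.Perm (Fin k)) :
    IsSemilinearSet {x : Fin n → ℤ | ∃ (r : Fin k → Fin n) (t : Fin k → ℤ),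
      (∀ a b, a < b → (r a + n * t a : ℤ) < r b + n * t b) ∧
      ∀ a b, x (r a) + n * t a < x (r b) + n * t b ↔ p a < p b} := by
  have h1 : ∀ (r : Fin k → Fin n) (a b : Fin k), IsSemilinearSet
      {z : (Fin n → ℤ) × (Fin k → ℤ) | a < b → (r a + n * z.2 a : ℤ) < r b + n * z.2 b} := by
    intro r a b
    by_cases hab : a < b
    · convert! isSemilinearSet_le (f := fun z : (Fin n → ℤ) × (Fin k → ℤ) =>
        n * z.2 b - n * z.2 a) (fun x y => by simp only [Prod.snd_add, Pi.add_apply]; ring)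
        ((r a : ℤ) + 1 - r b) using 1
      ext z
      simp only [hab, true_imp_iff, mem_ofPred_eq]
      constructor <;> intro h <;> linarith
    · simp [hab]
  have h2 : ∀ (r : Fin k → Fin n) (a b : Fin k), IsSemilinearSet
      {z : (Fin n → ℤ) × (Fin k → ℤ) |
        z.1 (r a) + n * z.2 a < z.1 (r b) + n * z.2 b ↔ p a < p b} := by
    intro r a b
    have h := isSemilinearSet_le (f := fun z : (Fin n → ℤ) × (Fin k → ℤ) =>
      z.1 (r b) + n * z.2 b - (z.1 (r a) + n * z.2 a))
      (fun x y => by simp only [Prod.fst_add, Prod.snd_add, Pi.add_apply]; ring) 1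
    by_cases hab : p a < p b
    · convert! h using 1
      ext z
      simp only [hab, iff_true, mem_ofPred_eq]
      constructor <;> intro h <;> linarith
    · convert! h.compl using 1
      ext z
      simp only [hab, iff_false, mem_compl_iff, mem_ofPred_eq, not_iff_not]
      constructor <;> intro h <;> linarith
  convert! IsSemilinearSet.iUnion fun r : Fin k → Fin n => isSemilinearSet_exists
    ((IsSemilinearSet.iInter fun a => IsSemilinearSet.iInter (h1 r a)).inter
      (IsSemilinearSet.iInter fun a => IsSemilinearSet.iInter (h2 r a))) using 1
  ext x
  simp only [mem_iUnion, mem_inter_iff, mem_iInter, mem_ofPred_eq]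

end window

/-! ### Assembly. -/

theorem isRationalSeries_generatingSeries {n : ℕ} (hn : 2 ≤ n) {k : ℕ} (p : Equiv.Perm (Fin k)) :
    IsRationalSeries (generatingSeries p n) := by
  have hn0 : 0 < n := by omega
  -- Recording the length as an extra coordinate makes the weight a linear map, the second
  -- projection, although the length is only piecewise linear (with floors) in the window.
  let Θ : AffineSymmetricGroup n → (Fin n → ℤ) × ℤ := fun w => (window w, coxeterLength n w)
  have hΘ : Function.Injective Θ := fun v w h => window_injective hn0 (congrArg Prod.fst h)
  let S : Set ((Fin n → ℤ) × ℤ) := Θ '' {w | Avoids w p}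
  have hS : IsSemilinearSet S := by
    have h1 := ((isSemilinearSet_isWindow n).inter (isSemilinearSet_contains n p).compl).preimage
      (AddMonoidHom.fst (Fin n → ℤ) ℤ)
    convert! h1.inter (isSemilinearSet_doubleInversions hn0) using 1
    ext ⟨x, m⟩
    constructor
    · rintro ⟨w, hw, h⟩
      obtain ⟨rfl, rfl⟩ := Prod.mk.inj h
      refine ⟨⟨isWindow_window w, fun h => hw ((contains_iff_window hn0 w p).2 h)⟩, ?_⟩
      exact (two_mul_coxeterLength hn w).trans (doubleInversions_eq_window w)
    · rintro ⟨⟨hx, hc⟩, hm⟩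
      obtain ⟨w, rfl⟩ := exists_window_eq hn0 hx
      refine ⟨w, fun h => hc ((contains_iff_window hn0 w p).1 h), Prod.ext rfl ?_⟩
      have h2 : 2 * m = 2 * (coxeterLength n w : ℤ) :=
        hm.trans ((two_mul_coxeterLength hn w).trans (doubleInversions_eq_window w)).symm
      change (coxeterLength n w : ℤ) = m
      omega
  have hser : weightSeries (AddMonoidHom.snd (Fin n → ℤ) ℤ) S = generatingSeries p n := by
    rw [weightSeries_image_of_eq (φ := fun w => (coxeterLength n w : ℤ)) hΘ.injOn
      (fun _ _ => by positivity) (fun _ _ => rfl)]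
    simp [weightSeries, generatingSeries]
  rw [← hser]
  refine isRationalSeries_of_isSemilinearSet hS ?_ fun m => ?_
  · rintro _ ⟨w, -, rfl⟩
    exact Int.natCast_nonneg _
  · refine ((finite_length_eq hn m).image Θ).subset ?_
    rintro _ ⟨⟨w, -, rfl⟩, hw⟩
    exact ⟨w, Int.natCast_inj.1 hw, rfl⟩

end AffinePattern

theorem corollary2p12 (n : ℕ) (hn : 2 ≤ n) (k : ℕ) (p : Equiv.Perm (Fin k)) :
    AffinePattern.IsRationalSeries (AffinePattern.generatingSeries p n) ∧
      ∃ E : LinearRecurrence ℚ,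
        E.IsSolution (fun m => PowerSeries.coeff m (AffinePattern.generatingSeries p n)) :=
  have h := AffinePattern.isRationalSeries_generatingSeries hn p
  ⟨h, h.exists_isSolution⟩
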